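/- Let $X$ be an infinite-dimensional Banach space over $F\in\{\mathbb{R},\mathbb{C}\}$, and call a bounded linear operator $T:X\to X$ supercyclic if there is a vector $k\in X$ such that the set $\{c\,T^n k : c\in F,\ n\ge 0\}$ is dense in $X$. Then: (1) no linear isometry $T:X\to X$ (surjective or not) is supercyclic; (2) if a bounded linear operator $T:X\to X$ is power bounded, i.e. $\sup_{n\ge 0}\|T^n\|<\infty$, and supercyclic, then $T^n x\to 0$ in norm as $n\to\infty$ for every $x\in X$. -/

import Mathlib

open Filter Topology

namespace Supercyclicity

variable {𝕜 X : Type*} [RCLike 𝕜] [NormedAddCommGroup X] [NormedSpace 𝕜 X]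

/-- The orbit `O(x) = {x, T x, T² x, …}` of a vector under a bounded operator. -/
def orbit (T : X →L[𝕜] X) (x : X) : Set X :=
  {y | ∃ n : ℕ, y = (T ^ n) x}

/-- The vector `k` is supercyclic for `T` if the set `𝕜 · O(k)` of all scalar multiples of
elements of its orbit is norm dense in `X`. -/
def IsSupercyclicVector (T : X →L[𝕜] X) (k : X) : Prop :=
  Dense {z : X | ∃ c : 𝕜, ∃ y ∈ orbit T k, z = c • y}

/-- An operator is supercyclic if it has a supercyclic vector. -/
def IsSupercyclic (T : X →L[𝕜] X) : Prop :=
  ∃ k : X, IsSupercyclicVector T k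

/-- An operator is power bounded if the norms of its powers are uniformly bounded. -/
def IsPowerBounded (T : X →L[𝕜] X) : Prop :=
  ∃ C : ℝ, ∀ n : ℕ, ‖T ^ n‖ ≤ C

end Supercyclicity

namespace Supercyclicity

variable {𝕜 X : Type*} [RCLike 𝕜] [NormedAddCommGroup X] [NormedSpace 𝕜 X]

/-! Let `p` be a continuous `T`-invariant norm and `k` supercyclic. For `S` commuting with `T`,
density gives `p (S x) * p k = p (S k) * p x`, so `S ↦ p (S k) / p k` is a multiplicative norm on
the commutant. By Gelfand–Mazur `T` satisfies a quadratic equation, hence `k` and `T k` span `X`.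
For an isometry take `p` to be the norm. For a power bounded operator take `p x = limsup ‖Tⁿ x‖`: if
`p k ≠ 0` it is a norm, which is excluded, so `p k = 0` and then `p = 0`. -/

/-- A closed condition invariant under scalars holds everywhere once it holds along the orbit of a
supercyclic vector. -/
theorem IsSupercyclicVector.induction {T : X →L[𝕜] X} {k : X} (hk : IsSupercyclicVector T k)
    {P : X → Prop} (hP : IsClosed {x | P x}) (h : ∀ (c : 𝕜) (n : ℕ), P (c • (T ^ n) k)) (x : X) :
    P x := by
  have hsub : {z : X | ∃ c : 𝕜, ∃ y ∈ orbit T k, z = c • y} ⊆ {x | P x} := by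
    rintro z ⟨c, y, ⟨n, rfl⟩, rfl⟩
    exact h c n
  have := hP.closure_subset_iff.2 hsub
  rw [hk.closure_eq] at this
  exact this (Set.mem_univ x)

theorem seminorm_pow_apply {T : X →L[𝕜] X} {p : Seminorm 𝕜 X} (hpT : ∀ x, p (T x) = p x) (n : ℕ)
    (x : X) : p ((T ^ n) x) = p x := by
  induction n with
  | zero => simp
  | succ n ih => rw [pow_succ', mul_apply_eq_comp, hpT, ih]

/-- Operators commuting with `T` scale a `T`-invariant seminorm. -/
theorem IsSupercyclicVector.seminorm_apply_mul {T : X →L[𝕜] X} {k : X}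
    (hk : IsSupercyclicVector T k) {p : Seminorm 𝕜 X} (hp : Continuous p)
    (hpT : ∀ x, p (T x) = p x) {S : X →L[𝕜] X} (hS : Commute S T) (x : X) :
    p (S x) * p k = p (S k) * p x := by
  refine hk.induction (P := fun x => p (S x) * p k = p (S k) * p x)
    (isClosed_eq (by fun_prop) (by fun_prop)) (fun c n => ?_) x
  have h : S ((T ^ n) k) = (T ^ n) (S k) := DFunLike.congr_fun (hS.pow_right n).eq k
  rw [map_smul, map_smul_eq_mul, map_smul_eq_mul, h, seminorm_pow_apply hpT,
    seminorm_pow_apply hpT]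
  ring

/-- A supercyclic operator satisfying a monic quadratic equation lives on a space of dimension at
most two. -/
theorem IsSupercyclicVector.finiteDimensional_of_sq {T : X →L[𝕜] X} {k : X}
    (hk : IsSupercyclicVector T k) {a b : 𝕜} (h : ∀ x, T (T x) = a • T x + b • x) :
    FiniteDimensional 𝕜 X := by
  set W : Submodule 𝕜 X := Submodule.span 𝕜 {k, T k} with hW
  have hfin : FiniteDimensional 𝕜 W := FiniteDimensional.span_of_finite 𝕜 (by simp)
  have hmem : ∀ n : ℕ, (T ^ n) k ∈ W ∧ (T ^ (n + 1)) k ∈ W := by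
    intro n
    induction n with
    | zero => exact ⟨Submodule.subset_span (by simp), Submodule.subset_span (by simp)⟩
    | succ n ih =>
      refine ⟨ih.2, ?_⟩
      have : (T ^ (n + 1 + 1)) k = a • (T ^ (n + 1)) k + b • (T ^ n) k := by
        simp only [pow_succ', mul_apply_eq_comp, h]
      rw [this]
      exact W.add_mem (W.smul_mem _ ih.2) (W.smul_mem _ ih.1)
  have htop : W = ⊤ := by
    refine eq_top_iff.2 fun x _ => ?_
    exact hk.induction (P := fun x => x ∈ W) W.closed_of_finiteDimensional
      (fun c n => W.smul_mem c (hmem n).1) x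
  exact Module.finite_def.2 (htop ▸ Submodule.fg_span (by simp))

/-- An element of an algebra over `ℝ` or `ℂ` with a multiplicative norm satisfies a monic real
quadratic equation. -/
theorem exists_quadratic_eq_zero_of_ringNorm {F : Type*} [Ring F] [Algebra 𝕜 F] (N : RingNorm F)
    (hsmul : ∀ (c : 𝕜) (x : F), N (c • x) = ‖c‖ * N x) (hone : N 1 = 1)
    (hmul : ∀ x y, N (x * y) = N x * N y) (x : F) :
    ∃ a b : ℝ, x ^ 2 - (a : 𝕜) • x + algebraMap 𝕜 F (b : 𝕜) = 0 := by
  let : NormedRing F := N.toNormedRing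
  -- Scalars are restricted to `ℝ` so that one real theorem covers both fields.
  let : Algebra ℝ F := Algebra.restrictScalars ℝ 𝕜 F
  have hr : ∀ (r : ℝ) (y : F), r • y = (r : 𝕜) • y := fun r y => by
    rw [← RCLike.algebraMap_eq_ofReal]; rfl
  let : NormedAlgebra ℝ F :=
    { norm_smul_le := fun r y => by
        rw [hr]
        exact (hsmul (r : 𝕜) y).le.trans_eq (by rw [RCLike.norm_ofReal, Real.norm_eq_abs]; rfl) }
  have : NormOneClass F := ⟨hone⟩
  have : NormMulClass F := ⟨hmul⟩
  obtain ⟨q, hq, hqx⟩ := NormedAlgebra.Real.exists_isMonicOfDegree_two_and_aeval_eq_zero x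
  obtain ⟨a, b, rfl⟩ := Polynomial.isMonicOfDegree_two_iff'.1 hq
  refine ⟨a, b, ?_⟩
  have halg : ∀ r : ℝ, algebraMap ℝ F r = algebraMap 𝕜 F (r : 𝕜) := fun r => by
    rw [Algebra.algebraMap_eq_smul_one, Algebra.algebraMap_eq_smul_one, hr]
  rw [← hqx]
  simp [Algebra.smul_def, halg]

/-- If a supercyclic operator preserves a continuous norm, then the underlying space is finite
dimensional: the commutant of the operator carries a multiplicative norm, so that the
Gelfand–Mazur theorem applies. -/
theorem IsSupercyclicVector.finiteDimensional {T : X →L[𝕜] X} {k : X}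
    (hk : IsSupercyclicVector T k) {p : Seminorm 𝕜 X} (hp : Continuous p)
    (hpT : ∀ x, p (T x) = p x) (hp0 : ∀ x, p x = 0 → x = 0) : FiniteDimensional 𝕜 X := by
  by_cases hk0 : p k = 0
  · have hz : ∀ x : X, x = 0 := by
      refine hk.induction (P := fun x => x = 0) isClosed_singleton fun c n => ?_
      simp [hp0 k hk0]
    have : Subsingleton X := ⟨fun x y => by rw [hz x, hz y]⟩
    infer_instance
  let F := Subalgebra.centralizer 𝕜 ({T} : Set (X →L[𝕜] X))
  have hF : ∀ S : F, Commute (S : X →L[𝕜] X) T := fun S =>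
    (Set.mem_centralizer_iff.1 S.2 T rfl).symm
  have hmul : ∀ S R : F, p ((S * R : F).1 k) / p k = p (S.1 k) / p k * (p (R.1 k) / p k) := by
    intro S R
    have := hk.seminorm_apply_mul hp hpT (hF S) (R.1 k)
    have h2 : (S * R : F).1 k = S.1 (R.1 k) := rfl
    rw [h2]
    field_simp
    linarith
  let N : RingNorm F :=
    { toFun := fun S => p (S.1 k) / p k
      map_zero' := by simp
      add_le' := fun S R => by
        rw [← add_div]
        gcongr
        exact map_add_le_add p (S.1 k) (R.1 k)
      neg' := fun S => by
        have : (-S : F).1 k = -(S.1 k) := rfl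
        simp only [this, map_neg_eq_map]
      mul_le' := fun S R => (hmul S R).le
      -- If `p (S k) = 0`, the scaling identity gives `p (S x) = 0` for all `x`, so `S = 0` because
      -- `p` is a norm.
      eq_zero_of_map_eq_zero' := fun S hS => by
        have hS' : p (S.1 k) = 0 := by simpa [hk0] using hS
        ext x
        have := hk.seminorm_apply_mul hp hpT (hF S) x
        rw [hS', zero_mul] at this
        simpa using hp0 _ ((mul_eq_zero.1 this).resolve_right hk0) }
  obtain ⟨a, b, hqT⟩ := exists_quadratic_eq_zero_of_ringNorm (𝕜 := 𝕜) N
    (fun c S => by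
      have : (c • S : F).1 k = c • S.1 k := rfl
      change p ((c • S : F).1 k) / p k = ‖c‖ * (p (S.1 k) / p k)
      rw [this, map_smul_eq_mul, mul_div_assoc])
    (div_self hk0) hmul ⟨T, Set.mem_centralizer_iff.2 (by simp)⟩
  refine hk.finiteDimensional_of_sq (a := (a : 𝕜)) (b := -(b : 𝕜)) fun x => ?_
  have h := congrArg (fun S : F => S.1 x) hqT
  have h' : T (T x) - (a : 𝕜) • T x + (b : 𝕜) • x = 0 := by
    rw [pow_two] at h
    exact h
  rw [neg_smul, ← sub_eq_add_neg, ← sub_eq_zero, ← h']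
  abel

/-- For a power bounded operator, `x ↦ limsup ‖Tⁿ x‖` is an invariant seminorm dominated by the
norm and detecting the orbits that tend to zero. -/
theorem IsPowerBounded.exists_seminorm {T : X →L[𝕜] X} {C : ℝ} (hC : ∀ n : ℕ, ‖T ^ n‖ ≤ C) :
    ∃ p : Seminorm 𝕜 X, (∀ x, p x ≤ C * ‖x‖) ∧ (∀ x, p (T x) = p x) ∧
      ∀ x, p x = 0 → Tendsto (fun n : ℕ => (T ^ n) x) atTop (𝓝 0) := by
  have hb : ∀ x n, ‖(T ^ n) x‖ ≤ C * ‖x‖ := fun x n => (T ^ n).le_of_opNorm_le (hC n) x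
  -- The tail suprema decrease in `n` to the limsup; replacing `x` by `T x` shifts `n` by one.
  let a : ℕ → X → ℝ := fun n x => ⨆ m, ‖(T ^ (n + m)) x‖
  have hbdd : ∀ n x, BddAbove (Set.range fun m => ‖(T ^ (n + m)) x‖) := fun n x =>
    ⟨C * ‖x‖, by rintro _ ⟨m, rfl⟩; exact hb x _⟩
  have hle : ∀ n m x, n ≤ m → ‖(T ^ m) x‖ ≤ a n x := fun n m x hnm => by
    have := le_ciSup (hbdd n x) (m - n)
    rwa [Nat.add_sub_cancel' hnm] at this
  have hanti : ∀ x, Antitone fun n => a n x := fun x n m hnm =>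
    ciSup_le fun j => hle n (m + j) x (by omega)
  have hnn : ∀ n x, 0 ≤ a n x := fun n x => (norm_nonneg _).trans (hle n n x le_rfl)
  let p : X → ℝ := fun x => ⨅ n, a n x
  have hlim : ∀ x, Tendsto (fun n => a n x) atTop (𝓝 (p x)) := fun x =>
    tendsto_atTop_ciInf (hanti x) ⟨0, by rintro _ ⟨n, rfl⟩; exact hnn n x⟩
  refine ⟨Seminorm.of p (fun x y => ?_) (fun c x => ?_), fun x => ?_, fun x => ?_, fun x hx => ?_⟩
  · refine le_of_tendsto_of_tendsto' (hlim (x + y)) ((hlim x).add (hlim y)) fun n =>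
      ciSup_le fun m => ?_
    rw [map_add]
    exact (norm_add_le _ _).trans
      (add_le_add (hle n _ x (Nat.le_add_right _ _)) (hle n _ y (Nat.le_add_right _ _)))
  · refine tendsto_nhds_unique (hlim (c • x)) (((hlim x).const_mul ‖c‖).congr fun n => ?_)
    simp only [a, map_smul, norm_smul]
    exact Real.mul_iSup_of_nonneg (norm_nonneg c) _
  · exact le_of_tendsto' (hlim x) fun n => ciSup_le fun m => hb x _
  · refine tendsto_nhds_unique (hlim (T x)) (((tendsto_add_atTop_iff_nat 1).2 (hlim x)).congr
      fun n => ?_)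
    refine iSup_congr fun m => ?_
    rw [show n + 1 + m = n + m + 1 by ring, pow_succ, mul_apply_eq_comp]
  · have hx' : p x = 0 := hx
    exact squeeze_zero_norm (fun n => hle n n x le_rfl) (hx' ▸ hlim x)

end Supercyclicity

theorem theorem4 {𝕜 : Type*} [RCLike 𝕜] {X : Type*} [NormedAddCommGroup X]
    [NormedSpace 𝕜 X] [CompleteSpace X] (hdim : ¬ FiniteDimensional 𝕜 X) :
    (∀ T : X →L[𝕜] X, Isometry T → ¬ Supercyclicity.IsSupercyclic T) ∧
    (∀ T : X →L[𝕜] X, Supercyclicity.IsPowerBounded T → Supercyclicity.IsSupercyclic T →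
      ∀ x : X, Tendsto (fun n : ℕ => (T ^ n) x) atTop (𝓝 0)) := by
  refine ⟨fun T hT ⟨k, hk⟩ => hdim ?_, fun T ⟨C, hC⟩ ⟨k, hk⟩ => ?_⟩
  · exact hk.finiteDimensional (p := normSeminorm 𝕜 X) continuous_norm
      (fun x => hT.norm_map_of_map_zero (map_zero T) x) fun x hx => norm_eq_zero.1 hx
  · obtain ⟨p, hpC, hpT, hp0⟩ := Supercyclicity.IsPowerBounded.exists_seminorm hC
    have hC0 : 0 ≤ C := (norm_nonneg _).trans (hC 0)
    have hp : Continuous p := Seminorm.continuous_of_le (q := C.toNNReal • normSeminorm 𝕜 X)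
      (continuous_norm.const_smul C.toNNReal) fun x => by
        simpa [NNReal.smul_def, hC0] using hpC x
    have hpk : p k = 0 := by
      by_contra hpk
      refine hdim (hk.finiteDimensional hp hpT fun x hx => ?_)
      -- On the orbit `p` is constant while the norm is at most `C * ‖k‖`; the resulting bound
      -- passes to the closure and makes `p` definite.
      have h : ‖x‖ * p k ≤ C * ‖k‖ * p x := by
        refine hk.induction (P := fun x => ‖x‖ * p k ≤ C * ‖k‖ * p x)
          (isClosed_le (by fun_prop) (by fun_prop)) (fun c n => ?_) x
        rw [map_smul_eq_mul, norm_smul, Supercyclicity.seminorm_pow_apply hpT]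
        calc ‖c‖ * ‖(T ^ n) k‖ * p k ≤ ‖c‖ * (C * ‖k‖) * p k := by
              gcongr
              exact (T ^ n).le_of_opNorm_le (hC n) k
          _ = C * ‖k‖ * (‖c‖ * p k) := by ring
      rw [hx, mul_zero] at h
      have hpos : 0 < p k := lt_of_le_of_ne (apply_nonneg p k) (Ne.symm hpk)
      exact norm_le_zero_iff.1 (nonpos_of_mul_nonpos_left h hpos)
    refine fun x => hp0 x (hk.induction (P := fun x => p x = 0)
      (isClosed_eq hp continuous_const) (fun c n => ?_) x)
    rw [map_smul_eq_mul, Supercyclicity.seminorm_pow_apply hpT, hpk, mul_zero]
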